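/- Let $a>1$, $h(x)=1+ax(1-x)$ for $x\in[0,1]$, and $u_a=8/(4+a)$. For $\nu>0$ consider the non-linear $M/M/1$ system for functions $t\mapsto\Gamma(t)=(\Gamma_k(t))_{k\ge 0}$, $t\ge 0$, with values in the set $\mathcal P(\mathbb N)$ of probability distributions on $\mathbb N=\{0,1,2,\dots\}$: \[ \dot\Gamma_0=\nu h(\Gamma_0)\Gamma_1-\Gamma_0,\qquad \dot\Gamma_k=\nu h(\Gamma_0)\Gamma_{k+1}+\Gamma_{k-1}-(\nu h(\Gamma_0)+1)\Gamma_k\quad(k\ge 1). \] A fixed point is a $\pi\in\mathcal P(\mathbb N)$ at which all right-hand sides vanish. Put $\|\mu-\pi\|_2^2=\sum_{k}(\mu_k-\pi_k)^2/\pi_k\in[0,\infty]$. A fixed point $\pi$ is called exponentially stable if there are $q,\varepsilon>0$ such that every solution with $\|\Gamma(0)-\pi\|_2\le\varepsilon$ satisfies $\|\Gamma(t)-\pi\|_2^2\le\|\Gamma(0)-\pi\|_2^2\,e^{-qt}$ for all $t\ge0$. Then there are a neighbourhood $I$ of $u_a$ with $I\subset(0,\infty)$ and a continuous function $\sigma:I\to(0,1)$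 with $\sigma(u_a)=1/2$ such that for every $\nu\in I$, with $S=\sigma(\nu)$: (i) $S=1-\dfrac{1}{\nu h(S)}$ and $|h'(S)|<\dfrac{1}{\nu S}\left(\dfrac{1}{\sqrt{1-S}}-1\right)^2$; (ii) the geometric distribution $\pi_S(n)=\left(\frac{1}{\nu h(S)}\right)^n\left(1-\frac{1}{\nu h(S)}\right)$, $n\in\mathbb N$, is an exponentially stable fixed point; (iii) every fixed point $\pi$ satisfies $\pi(0)\le S$, with equality only for $\pi=\pi_S$; (iv) if $a<4$ or $\nu\ge1$, then $\pi_S$ is the unique fixed point in $\mathcal P(\mathbb N)$. -/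

import Mathlib

open Set Filter Topology
open scoped ENNReal

namespace NonlinearMM1

/-- `p` is a probability distribution on `ℕ`. -/
structure IsProbDist (p : ℕ → ℝ) : Prop where
  nonneg : ∀ k, 0 ≤ p k
  hasSum_one : HasSum p 1

/-- The function `h(x) = 1 + a x (1 - x)`. -/
def darRate (a x : ℝ) : ℝ := 1 + a * x * (1 - x)

/-- The right-hand side of the non-linear M/M/1 system: arrivals at rate `1`,
services at rate `ν h(γ₀)`. -/
def field (ν : ℝ) (h : ℝ → ℝ) (γ : ℕ → ℝ) : ℕ → ℝ
  | 0 => ν * h (γ 0) * γ 1 - γ 0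
  | k + 1 => ν * h (γ 0) * γ (k + 2) + γ k - (ν * h (γ 0) + 1) * γ (k + 1)

/-- `Γ` is a solution on `[0, ∞)` of the non-linear M/M/1 system, with values in the set of
probability distributions on `ℕ` (at `t = 0` the derivative is the right derivative; values of
`Γ` at negative times are irrelevant). -/
structure IsSolution (ν : ℝ) (h : ℝ → ℝ) (Γ : ℝ → ℕ → ℝ) : Prop where
  isProbDist : ∀ t, 0 ≤ t → IsProbDist (Γ t)
  hasDeriv : ∀ t, 0 ≤ t → ∀ k,
    HasDerivWithinAt (fun s => Γ s k) (field ν h (Γ t) k) (Ici 0) t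

/-- `p` is a fixed point (equilibrium) of the system in the set of probability distributions. -/
def IsFixedPoint (ν : ℝ) (h : ℝ → ℝ) (p : ℕ → ℝ) : Prop :=
  IsProbDist p ∧ ∀ k, field ν h p k = 0

/-- The squared distance `‖μ - p‖₂² = ∑ₖ (μ(k) - p(k))² / p(k) ∈ [0, ∞]`. -/
noncomputable def distSq (μ p : ℕ → ℝ) : ℝ≥0∞ :=
  ∑' k, ENNReal.ofReal ((μ k - p k) ^ 2) / ENNReal.ofReal (p k)

/-- `p` is an exponentially stable equilibrium point: it is a fixed point and there are
`q, ε > 0` such that `‖Γ(0) - p‖₂ ≤ ε` implies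
`‖Γ(t) - p‖₂² ≤ ‖Γ(0) - p‖₂² e^{-q t}` for all `t ≥ 0`. -/
def IsExpStable (ν : ℝ) (h : ℝ → ℝ) (p : ℕ → ℝ) : Prop :=
  IsFixedPoint ν h p ∧
  ∃ q > (0 : ℝ), ∃ ε > (0 : ℝ), ∀ Γ : ℝ → ℕ → ℝ, IsSolution ν h Γ →
    distSq (Γ 0) p ≤ ENNReal.ofReal (ε ^ 2) →
    ∀ t, 0 ≤ t → distSq (Γ t) p ≤ distSq (Γ 0) p * ENNReal.ofReal (Real.exp (-q * t))

/-- The geometric distribution `π_S(n) = (1/(ν h(S)))ⁿ (1 - 1/(ν h(S)))`, the invariant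
distribution of the M/M/1 queue with arrival rate `1` and service rate `ν h(S)`. -/
noncomputable def piS (ν : ℝ) (h : ℝ → ℝ) (S : ℝ) (n : ℕ) : ℝ :=
  (1 / (ν * h S)) ^ n * (1 - 1 / (ν * h S))

/-- The stability condition `|h'(S)| < (1/(ν S)) (1/√(1 - S) - 1)²`. -/
def StabilityCondition (ν : ℝ) (h : ℝ → ℝ) (S : ℝ) : Prop :=
  |deriv h S| < 1 / (ν * S) * (1 / √(1 - S) - 1) ^ 2

end NonlinearMM1

open NonlinearMM1

/-! Stability. Let `c = √(ν h(S))` and `y k = c ^ k * (γ k - π_S k)`; then `‖γ - π_S‖² = A / S` with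
`A = ∑ y k ^ 2`. With the service rate frozen at `c ^ 2`, `A` would decay at rate `2 (c - 1) ^ 2`,
by the M/M/1 spectral gap (`spectralGap`). The true rate deviates by `δ = ν h(γ 0) - c ^ 2`. This
adds to `A' / 2` the term `δ S (γ 0 - S)`, at most `ν S |h'(S)| A` to leading order, and terms
bounded by `2 |δ| A`, of third order (`hasSum_mul_field`, `tsum_mul_field_le`). Since `c = 1 / √(1 -
S)`, the stability condition says exactly `ν S |h'(S)| < (c - 1) ^ 2`. So `A' ≤ -κ A` while `A` is
small, and a barrier argument closes the estimate (`le_mul_exp_of_deriv_le`).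

A solution is only differentiable component by component, so differentiating `∑ c ^ (2 k) Γ k ^ 2`
needs a summable majorant on bounded time intervals: `IsSolution.exists_majorant`.

Fixed points. The flux between neighbours vanishes, so a fixed point is geometric, and its mass `x`
at `0` solves `F x = 1 / ν` for `F x = (1 - x) h(x)`. Here `F (1/2) = 1 / u_a` and `F' (1/2) = -(1 +
a/4) ≠ 0`, so `σ` comes from the inverse function theorem; as `h' (1/2) = 0`, the stability
condition holds at `u_a` and persists nearby. `F` decreases on `[1/3, 1]`, so a root above `1/3` is
the largest. For `ν ≥ 1`, automatic near `u_a` when `a < 4`, two distinct roots in `(0, 1)`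
contradict Vieta's formulas. -/

namespace NonlinearMM1

/-! ### Series shifted by one index -/

/-- The sequence `0, y 0, y 1, …`. -/
def prev (y : ℕ → ℝ) : ℕ → ℝ
  | 0 => 0
  | k + 1 => y k

theorem hasSum_prev {y : ℕ → ℝ} {s : ℝ} (hy : HasSum y s) : HasSum (prev y) s := by
  refine (hasSum_nat_add_iff' 1).1 ?_
  simpa [prev] using hy

theorem hasSum_succ {y : ℕ → ℝ} {s : ℝ} (hy : HasSum y s) :
    HasSum (fun k => y (k + 1)) (s - y 0) := by
  simpa using (hasSum_nat_add_iff' 1).2 hy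

theorem summable_mul_succ {y : ℕ → ℝ} (hy : Summable fun k => y k ^ 2) :
    Summable fun k => y k * y (k + 1) := by
  refine Summable.of_norm_bounded (hy.add ((summable_nat_add_iff 1).2 hy)) fun k => ?_
  rw [Real.norm_eq_abs, abs_le]
  constructor <;> nlinarith [sq_nonneg (y k - y (k + 1)), sq_nonneg (y k + y (k + 1)),
    sq_nonneg (y k), sq_nonneg (y (k + 1))]

/-! ### The spectral gap of the M/M/1 queue -/

/-- A square summable sequence orthogonal to `(c⁻ᵏ)ₖ` has a controlled first term. -/
theorem sq_zero_le_of_orthogonal {c A P : ℝ} (hc : 1 < c) {y : ℕ → ℝ}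
    (hA : HasSum (fun k => y k ^ 2) A) (hP : HasSum (fun k => y k * y (k + 1)) P)
    (h0 : HasSum (fun k => c⁻¹ ^ k * y k) 0) :
    (c ^ 2 - 1) * y 0 ^ 2 ≤ 2 * A - y 0 ^ 2 - 2 * P := by
  have hc0 : 0 < c := by linarith
  have hm : 0 < c ^ 2 - 1 := by nlinarith
  have hθ : c⁻¹ ^ 2 < 1 := pow_lt_one₀ (by positivity) (inv_lt_one_of_one_lt₀ hc) two_ne_zero
  -- Abel summation of the orthogonality relation expresses `y 0` through the increments.
  have habel : HasSum (fun k => c⁻¹ ^ (k + 1) * (y (k + 1) - y k)) (-y 0) := by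
    have := (hasSum_succ h0).sub (h0.mul_left c⁻¹)
    convert! this using 1
    · ext k; ring
    · ring
  have hΔ : HasSum (fun k => (y (k + 1) - y k) ^ 2) (2 * A - y 0 ^ 2 - 2 * P) := by
    have := ((hasSum_succ hA).add hA).sub (hP.mul_left 2)
    convert! this using 1
    · ext k; ring
    · ring
  have hgeo : HasSum (fun k : ℕ => (c⁻¹ ^ 2) ^ k) (1 - c⁻¹ ^ 2)⁻¹ :=
    hasSum_geometric_of_lt_one (by positivity) hθ
  have hgeo' : (c⁻¹ ^ 2) * (1 - c⁻¹ ^ 2)⁻¹ = 1 / (c ^ 2 - 1) := by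
    have : 1 - c⁻¹ ^ 2 = (c ^ 2 - 1) / c ^ 2 := by field_simp
    rw [this]; field_simp
  -- Cauchy–Schwarz as a termwise completed square; the multiplier `(c ^ 2 - 1) * y 0` is the
  -- optimal one.
  have key := hasSum_le (fun k => ?_) (habel.mul_left (-(2 * (c ^ 2 - 1) * y 0)))
    (hΔ.add ((hgeo.mul_left (c⁻¹ ^ 2)).mul_left ((c ^ 2 - 1) ^ 2 * y 0 ^ 2)))
  · rw [hgeo'] at key
    have : (c ^ 2 - 1) ^ 2 * y 0 ^ 2 * (1 / (c ^ 2 - 1)) = (c ^ 2 - 1) * y 0 ^ 2 := by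
      field_simp
    rw [this] at key
    linarith
  · have : (c ^ 2 - 1) ^ 2 * y 0 ^ 2 * (c⁻¹ ^ 2 * (c⁻¹ ^ 2) ^ k)
        = ((c ^ 2 - 1) * y 0 * c⁻¹ ^ (k + 1)) ^ 2 := by
      rw [← pow_mul]; ring
    rw [this]
    nlinarith [sq_nonneg ((c ^ 2 - 1) * y 0 * c⁻¹ ^ (k + 1) + (y (k + 1) - y k))]

/-- Spectral gap inequality for the M/M/1 queue with arrival rate `1` and service rate `c ^ 2`,
written for the densities multiplied by the square root of the invariant measure. -/
theorem spectralGap {c A P : ℝ} (hc : 1 < c) {y : ℕ → ℝ}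
    (hA : HasSum (fun k => y k ^ 2) A) (hP : HasSum (fun k => y k * y (k + 1)) P)
    (h0 : HasSum (fun k => c⁻¹ ^ k * y k) 0) :
    (c - 1) ^ 2 * A ≤ c ^ 2 * (A - y 0 ^ 2) + A - 2 * c * P := by
  have h := sq_zero_le_of_orthogonal hc hA hP h0
  have h1 : c * y 0 ^ 2 ≤ 2 * A - 2 * P := by
    nlinarith [mul_nonneg (mul_nonneg (by linarith : 0 ≤ c) (by linarith : 0 ≤ c - 1))
      (sq_nonneg (y 0))]
  nlinarith

/-! ### A summable majorant for a convolution with a geometric kernel -/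

/-- Each column sum is at most `x k` times the full two-sided geometric series, so Tonelli applies.
-/
theorem summable_geometric_convolution {θ : ℝ} (h0 : 0 ≤ θ) (h1 : θ < 1) {x : ℕ → ℝ}
    (hx0 : ∀ k, 0 ≤ x k) (hx : Summable x) :
    (∀ N : ℕ, Summable fun k : ℕ => θ ^ ((N : ℤ) - k).natAbs * x k) ∧
      Summable fun N : ℕ => ∑' k : ℕ, θ ^ ((N : ℤ) - k).natAbs * x k := by
  have hz : Summable fun z : ℤ => θ ^ z.natAbs := by
    apply Summable.of_nat_of_neg <;> simpa using summable_geometric_of_lt_one h0 h1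
  have hinj : ∀ k : ℕ, Function.Injective fun N : ℕ => (N : ℤ) - k := fun k a b h => by
    simpa using h
  have hcol : ∀ k : ℕ, Summable fun N : ℕ => θ ^ ((N : ℤ) - k).natAbs * x k := fun k =>
    (hz.comp_injective (hinj k)).mul_right _
  have hsum : Summable fun p : ℕ × ℕ => θ ^ ((p.2 : ℤ) - p.1).natAbs * x p.1 := by
    refine (summable_prod_of_nonneg fun p => mul_nonneg (pow_nonneg h0 _) (hx0 _)).2 ⟨hcol, ?_⟩
    refine Summable.of_nonneg_of_le
      (fun k => tsum_nonneg fun N => mul_nonneg (pow_nonneg h0 _) (hx0 _)) (fun k => ?_)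
      (hx.mul_left (∑' z : ℤ, θ ^ z.natAbs))
    simp only [tsum_mul_right]
    exact mul_le_mul_of_nonneg_right (tsum_comp_le_tsum_of_inj hz
      (fun z => pow_nonneg h0 _) (hinj k)) (hx0 k)
  have hswap := hsum.prod_symm
  exact ⟨fun N => hswap.prod_factor N, hswap.prod⟩

/-! ### Weighted square sums along a solution -/

theorem IsProbDist.le_one {p : ℕ → ℝ} (hp : IsProbDist p) (k : ℕ) : p k ≤ 1 :=
  le_hasSum hp.hasSum_one k fun j _ => hp.nonneg j

theorem IsProbDist.mem_Icc {p : ℕ → ℝ} (hp : IsProbDist p) (k : ℕ) : p k ∈ Icc (0 : ℝ) 1 :=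
  ⟨hp.nonneg k, hp.le_one k⟩

theorem field_eq_flux (ν : ℝ) (h : ℝ → ℝ) (γ : ℕ → ℝ) (k : ℕ) :
    field ν h γ k = prev (fun j => γ j - ν * h (γ 0) * γ (j + 1)) k
      - (γ k - ν * h (γ 0) * γ (k + 1)) := by
  cases k <;> simp only [field, prev] <;> ring

/-- Young's inequality on the products of neighbours; `3 * B + 3` collects `B + 1` from these and `2
* (B + 1)` from the diagonal term. -/
theorem abs_mul_field_le {ν B : ℝ} {h : ℝ → ℝ} {γ : ℕ → ℝ} (hγ : ∀ k, 0 ≤ γ k)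
    (hb : 0 ≤ ν * h (γ 0)) (hB : ν * h (γ 0) ≤ B) (k : ℕ) :
    |2 * γ k * field ν h γ k|
      ≤ prev (fun j => γ j ^ 2) k + B * γ (k + 1) ^ 2 + (3 * B + 3) * γ k ^ 2 := by
  set b := ν * h (γ 0) with hbdef
  have key : ∀ x y z : ℝ, 0 ≤ x → 0 ≤ y → 0 ≤ z →
      |2 * y * (b * z + x - (b + 1) * y)| ≤ x ^ 2 + B * z ^ 2 + (3 * B + 3) * y ^ 2 := by
    intro x y z hx hy hz
    have h1 : 0 ≤ b * (y * z) := by positivity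
    have h2 : b * (2 * (y * z)) ≤ B * (y ^ 2 + z ^ 2) :=
      mul_le_mul hB (by nlinarith [sq_nonneg (y - z)]) (by positivity) (hb.trans hB)
    have h3 : b * y ^ 2 ≤ B * y ^ 2 := mul_le_mul_of_nonneg_right hB (sq_nonneg y)
    have h4 : 0 ≤ b * y ^ 2 := by positivity
    have h5 : 2 * (x * y) ≤ x ^ 2 + y ^ 2 := by nlinarith [sq_nonneg (x - y)]
    have h6 : 0 ≤ x * y := by positivity
    have h7 : 0 ≤ B * z ^ 2 := mul_nonneg (hb.trans hB) (sq_nonneg z)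
    rw [abs_le]
    constructor <;> nlinarith [sq_nonneg x, sq_nonneg y]
  cases k with
  | zero =>
    have h1 := key 0 (γ 0) (γ 1) le_rfl (hγ 0) (hγ 1)
    have h2 : 0 ≤ b * (γ 0 * γ 1) := mul_nonneg hb (mul_nonneg (hγ 0) (hγ 1))
    have h3 : 0 ≤ b * γ 0 ^ 2 := mul_nonneg hb (sq_nonneg _)
    have h4 : 0 ≤ B * γ 1 ^ 2 := mul_nonneg (hb.trans hB) (sq_nonneg _)
    simp only [field, prev, ← hbdef]
    rw [abs_le] at h1 ⊢
    have h5 : b * (2 * (γ 0 * γ 1)) ≤ B * (γ 0 ^ 2 + γ 1 ^ 2) :=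
      mul_le_mul hB (by nlinarith [sq_nonneg (γ 0 - γ 1)])
        (mul_nonneg two_pos.le (mul_nonneg (hγ 0) (hγ 1))) (hb.trans hB)
    have h6 : b * γ 0 ^ 2 ≤ B * γ 0 ^ 2 := mul_le_mul_of_nonneg_right hB (sq_nonneg _)
    constructor <;> norm_num <;> nlinarith [sq_nonneg (γ 0)]
  | succ k => exact key (γ k) (γ (k + 1)) (γ (k + 2)) (hγ _) (hγ _) (hγ _)

/-- A weight whose consecutive values are comparable up to the factor `K`. -/
structure IsModerateWeight (K : ℝ) (w : ℕ → ℝ) : Prop where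
  nonneg : ∀ k, 0 ≤ w k
  le_succ : ∀ k, w k ≤ K * w (k + 1)
  succ_le : ∀ k, w (k + 1) ≤ K * w k

section

variable {ν B K : ℝ} {h : ℝ → ℝ}

theorem abs_weighted_field_le {γ w u : ℕ → ℝ} (hγ : IsProbDist γ)
    (hB : ∀ x ∈ Icc (0 : ℝ) 1, 0 ≤ ν * h x ∧ ν * h x ≤ B) (hK : 0 ≤ K)
    (hw : IsModerateWeight K w) (hu : ∀ k, w k * γ k ^ 2 ≤ u k) (k : ℕ) :
    |w k * (2 * γ k * field ν h γ k)|
      ≤ K * prev u k + B * K * u (k + 1) + (3 * B + 3) * u k := by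
  obtain ⟨hb0, hbB⟩ := hB _ (hγ.mem_Icc 0)
  have hB0 := hb0.trans hbB
  have h1 : w k * prev (fun j => γ j ^ 2) k ≤ K * prev u k := by
    cases k with
    | zero => simp [prev]
    | succ k =>
      calc w (k + 1) * γ k ^ 2 ≤ K * w k * γ k ^ 2 :=
            mul_le_mul_of_nonneg_right (hw.succ_le k) (sq_nonneg _)
        _ ≤ K * u k := by rw [mul_assoc]; exact mul_le_mul_of_nonneg_left (hu k) hK
  have h2 : w k * (B * γ (k + 1) ^ 2) ≤ B * K * u (k + 1) :=
    calc w k * (B * γ (k + 1) ^ 2) ≤ K * w (k + 1) * (B * γ (k + 1) ^ 2) :=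
          mul_le_mul_of_nonneg_right (hw.le_succ k) (mul_nonneg hB0 (sq_nonneg _))
      _ = B * K * (w (k + 1) * γ (k + 1) ^ 2) := by ring
      _ ≤ _ := mul_le_mul_of_nonneg_left (hu _) (mul_nonneg hB0 hK)
  have h3 : w k * ((3 * B + 3) * γ k ^ 2) ≤ (3 * B + 3) * u k := by
    rw [mul_left_comm]; exact mul_le_mul_of_nonneg_left (hu k) (by linarith)
  rw [abs_mul, abs_of_nonneg (hw.nonneg k)]
  refine (mul_le_mul_of_nonneg_left (abs_mul_field_le hγ.nonneg hb0 hbB k) (hw.nonneg k)).trans ?_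
  linarith

theorem hasSum_majorant {u : ℕ → ℝ} (hu : Summable u) :
    HasSum (fun k => K * prev u k + B * K * u (k + 1) + (3 * B + 3) * u k)
      (K * (∑' k, u k) + B * K * (∑' k, u k - u 0) + (3 * B + 3) * ∑' k, u k) :=
  ((((hasSum_prev hu.hasSum).mul_left K).add ((hasSum_succ hu.hasSum).mul_left (B * K)))).add
    (hu.hasSum.mul_left _)

/-- Because neighbouring weights are comparable, a majorant of the terms also yields one of their
time derivatives, which justifies termwise differentiation. -/
theorem IsSolution.weighted_regularity {Γ : ℝ → ℕ → ℝ} {w u : ℕ → ℝ} {T : ℝ}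
    (hΓ : IsSolution ν h Γ) (hB : ∀ x ∈ Icc (0 : ℝ) 1, 0 ≤ ν * h x ∧ ν * h x ≤ B) (hK : 0 ≤ K)
    (hw : IsModerateWeight K w) (hu : Summable u)
    (hwu : ∀ t ∈ Icc 0 T, ∀ k, w k * Γ t k ^ 2 ≤ u k) :
    ContinuousOn (fun t => ∑' k, w k * Γ t k ^ 2) (Icc 0 T) ∧
      ∀ t ∈ Ioo 0 T, HasDerivAt (fun t => ∑' k, w k * Γ t k ^ 2)
        (∑' k, w k * (2 * Γ t k * field ν h (Γ t) k)) t := by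
  have hnn : ∀ t k, 0 ≤ w k * Γ t k ^ 2 := fun t k => mul_nonneg (hw.nonneg k) (sq_nonneg _)
  constructor
  · refine continuousOn_tsum (fun k => ?_) hu fun k t ht => ?_
    · refine continuousOn_const.mul (ContinuousOn.pow (fun t ht => ?_) 2)
      exact ((hΓ.hasDeriv t ht.1 k).continuousWithinAt).mono Icc_subset_Ici_self
    · rw [Real.norm_of_nonneg (hnn t k)]; exact hwu t ht k
  · intro t ht
    refine hasDerivAt_tsum_of_isPreconnected (𝕜 := ℝ) (F := ℝ) (t := Ioo 0 T)
      (g := fun k s => w k * Γ s k ^ 2)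
      (g' := fun k s => w k * (2 * Γ s k * field ν h (Γ s) k))
      (hasSum_majorant (K := K) (B := B) hu).summable
      isOpen_Ioo isPreconnected_Ioo (fun k s hs => ?_) (fun k s hs => ?_) ht ?_ ht
    · have h1 : HasDerivAt (fun s => Γ s k) (field ν h (Γ s) k) s :=
        (hΓ.hasDeriv s hs.1.le k).hasDerivAt (Ici_mem_nhds hs.1)
      simpa using (h1.pow 2).const_mul (w k)
    · exact abs_weighted_field_le (hΓ.isProbDist s hs.1.le) hB hK hw
        (hwu s (Ioo_subset_Icc_self hs)) k
    · exact Summable.of_nonneg_of_le (hnn t) (hwu t (Ioo_subset_Icc_self ht)) hu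

/-- Exponential growth bound for square sums with a summable weight. -/
theorem IsSolution.weighted_growth {Γ : ℝ → ℕ → ℝ} {w : ℕ → ℝ}
    (hΓ : IsSolution ν h Γ) (hB : ∀ x ∈ Icc (0 : ℝ) 1, 0 ≤ ν * h x ∧ ν * h x ≤ B) (hK : 0 ≤ K)
    (hw : IsModerateWeight K w) (hws : Summable w) {t : ℝ} (ht : 0 ≤ t) :
    ∑' k, w k * Γ t k ^ 2
      ≤ Real.exp ((K + B * K + (3 * B + 3)) * t) * ∑' k, w k * Γ 0 k ^ 2 := by
  set C := K + B * K + (3 * B + 3) with hC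
  set Y : ℝ → ℝ := fun t => ∑' k, w k * Γ t k ^ 2 with hY
  have hwu : ∀ t, 0 ≤ t → ∀ k, w k * Γ t k ^ 2 ≤ w k := fun t ht k =>
    mul_le_of_le_one_right (hw.nonneg k)
      (pow_le_one₀ ((hΓ.isProbDist t ht).nonneg k) ((hΓ.isProbDist t ht).le_one k))
  obtain ⟨hc, hd⟩ := hΓ.weighted_regularity (T := t) hB hK hw hws fun s hs => hwu s hs.1
  have hsum : ∀ s, 0 ≤ s → Summable fun k => w k * Γ s k ^ 2 := fun s hs =>
    Summable.of_nonneg_of_le (fun k => mul_nonneg (hw.nonneg k) (sq_nonneg _)) (hwu s hs) hws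
  have hB0 : 0 ≤ B := (hB 0 (by simp)).1.trans (hB 0 (by simp)).2
  have hbound : ∀ s, 0 ≤ s → ∑' k, w k * (2 * Γ s k * field ν h (Γ s) k) ≤ C * Y s := by
    intro s hs
    have hmaj := hasSum_majorant (K := K) (B := B) (hsum s hs)
    have habs := abs_weighted_field_le (hΓ.isProbDist s hs) hB hK hw fun k => le_rfl
    refine (hasSum_le (fun k => (le_abs_self _).trans (habs k))
      (Summable.of_norm_bounded hmaj.summable habs).hasSum hmaj).trans ?_
    have : 0 ≤ B * K * (w 0 * Γ s 0 ^ 2) :=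
      mul_nonneg (mul_nonneg hB0 hK) (mul_nonneg (hw.nonneg 0) (sq_nonneg _))
    simp only [hC, hY]
    linarith
  -- Grönwall's inequality for `Y' ≤ C * Y`.
  have hanti : AntitoneOn (fun s => Real.exp (-C * s) * Y s) (Icc 0 t) := by
    have hderiv : ∀ s ∈ Ioo 0 t, HasDerivAt (fun s => Real.exp (-C * s) * Y s)
        (Real.exp (-C * s) * (-C * 1) * Y s + Real.exp (-C * s) *
          ∑' k, w k * (2 * Γ s k * field ν h (Γ s) k)) s := fun s hs =>
      (((hasDerivAt_id s).const_mul (-C)).exp).mul (hd s hs)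
    refine antitoneOn_of_deriv_nonpos (convex_Icc 0 t) ?_ ?_ ?_
    · exact (by fun_prop : Continuous fun s => Real.exp (-C * s)).continuousOn.mul hc
    · rw [interior_Icc]
      exact fun s hs => (hderiv s hs).differentiableAt.differentiableWithinAt
    · rw [interior_Icc]
      intro s hs
      rw [(hderiv s hs).deriv]
      nlinarith [mul_le_mul_of_nonneg_left (hbound s hs.1.le) (Real.exp_pos (-C * s)).le]
  have := hanti (left_mem_Icc.2 ht) (right_mem_Icc.2 ht) ht
  simp only [mul_zero, Real.exp_zero, one_mul, neg_mul, Real.exp_neg] at this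
  rwa [inv_mul_le_iff₀ (Real.exp_pos _)] at this

/-! ### Propagation of the weighted square summability -/

theorem isModerateWeight_two_sided {r : ℝ} (hr : 1 < r) (N : ℕ) :
    IsModerateWeight r fun k : ℕ => r⁻¹ ^ ((N : ℤ) - k).natAbs := by
  have hr0 : 0 < r := by linarith
  have hstep : ∀ m n : ℕ, n ≤ m + 1 → r⁻¹ ^ m ≤ r * r⁻¹ ^ n := fun m n hmn => by
    have : r⁻¹ ^ (m + 1) ≤ r⁻¹ ^ n :=
      pow_le_pow_of_le_one (by positivity) (inv_le_one_of_one_le₀ hr.le) hmn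
    calc r⁻¹ ^ m = r * r⁻¹ ^ (m + 1) := by rw [pow_succ]; field_simp
      _ ≤ _ := mul_le_mul_of_nonneg_left this hr0.le
  exact ⟨fun k => by positivity, fun k => hstep _ _ (by omega), fun k => hstep _ _ (by omega)⟩

theorem summable_two_sided {θ : ℝ} (h0 : 0 ≤ θ) (h1 : θ < 1) (N : ℕ) :
    Summable fun k : ℕ => θ ^ ((N : ℤ) - k).natAbs := by
  have hz : Summable fun z : ℤ => θ ^ z.natAbs := by
    apply Summable.of_nat_of_neg <;> simpa using summable_geometric_of_lt_one h0 h1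
  exact hz.comp_injective (i := fun k : ℕ => (N : ℤ) - k) fun a b hab => by simpa using hab

/-- Of the decay `β ^ (-2 |N - k|)`, one factor pays for moving the weight `β ^ N` to `β ^ k`; the
other remains as a summable kernel. -/
theorem pow_mul_two_sided_le {β : ℝ} (hβ : 1 < β) (N k : ℕ) :
    β ^ N * (β ^ 2)⁻¹ ^ ((N : ℤ) - k).natAbs ≤ β⁻¹ ^ ((N : ℤ) - k).natAbs * β ^ k := by
  have hβ0 : 0 < β := by linarith
  set m := ((N : ℤ) - k).natAbs with hm
  have hNk : β ^ N ≤ β ^ m * β ^ k := by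
    rw [← pow_add]; exact pow_le_pow_right₀ hβ.le (by omega)
  calc β ^ N * (β ^ 2)⁻¹ ^ m ≤ β ^ m * β ^ k * (β ^ 2)⁻¹ ^ m :=
        mul_le_mul_of_nonneg_right hNk (by positivity)
    _ = β⁻¹ ^ m * β ^ k := by
        rw [inv_pow, inv_pow, ← pow_mul, mul_comm 2 m, pow_mul, sq]
        field_simp

/-- If `∑ βᵏ Γₖ(0)²` is finite then the terms `βᵏ Γₖ(t)²` are dominated by a summable sequence,
uniformly on bounded time intervals. -/
theorem IsSolution.exists_majorant {Γ : ℝ → ℕ → ℝ} {β : ℝ}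
    (hΓ : IsSolution ν h Γ) (hB : ∀ x ∈ Icc (0 : ℝ) 1, 0 ≤ ν * h x ∧ ν * h x ≤ B)
    (hβ : 1 < β) (h0 : Summable fun k => β ^ k * Γ 0 k ^ 2) (T : ℝ) :
    ∃ u : ℕ → ℝ, Summable u ∧ ∀ t ∈ Icc 0 T, ∀ k, β ^ k * Γ t k ^ 2 ≤ u k := by
  have hβ0 : 0 < β := by linarith
  have hr : 1 < β ^ 2 := one_lt_pow₀ hβ two_ne_zero
  have hB0 : 0 ≤ B := (hB 0 (by simp)).1.trans (hB 0 (by simp)).2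
  set C := β ^ 2 + B * β ^ 2 + (3 * B + 3) with hC
  have hC0 : 0 ≤ C := by positivity
  obtain ⟨hrow, hconv⟩ := summable_geometric_convolution (θ := β⁻¹) (by positivity)
    (inv_lt_one_of_one_lt₀ hβ) (fun k => by positivity) h0
  refine ⟨_, hconv.mul_left (Real.exp (C * T)), fun t ht N => ?_⟩
  have hws := summable_two_sided (θ := (β ^ 2)⁻¹) (by positivity) (inv_lt_one_of_one_lt₀ hr) N
  have hsum : ∀ s, 0 ≤ s → Summable fun k : ℕ =>
      (β ^ 2)⁻¹ ^ ((N : ℤ) - k).natAbs * Γ s k ^ 2 := fun s hs =>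
    Summable.of_nonneg_of_le (fun k => by positivity) (fun k => mul_le_of_le_one_right
      (by positivity) (pow_le_one₀ ((hΓ.isProbDist s hs).nonneg k)
        ((hΓ.isProbDist s hs).le_one k))) hws
  -- A weight peaked at `N` is summable, so the growth bound applies with no assumption on `Γ 0`,
  -- and it controls `Γ t N ^ 2` alone.
  have hgrow := hΓ.weighted_growth hB (by positivity) (isModerateWeight_two_sided hr N) hws ht.1
  rw [← hC] at hgrow
  have hterm : Γ t N ^ 2 ≤ ∑' k : ℕ, (β ^ 2)⁻¹ ^ ((N : ℤ) - k).natAbs * Γ t k ^ 2 := by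
    simpa using (hsum t ht.1).le_tsum N fun k _ => by positivity
  have hexp : Real.exp (C * t) ≤ Real.exp (C * T) :=
    Real.exp_le_exp.2 (mul_le_mul_of_nonneg_left ht.2 hC0)
  have hcmp : β ^ N * ∑' k : ℕ, (β ^ 2)⁻¹ ^ ((N : ℤ) - k).natAbs * Γ 0 k ^ 2
      ≤ ∑' k : ℕ, β⁻¹ ^ ((N : ℤ) - k).natAbs * (β ^ k * Γ 0 k ^ 2) := by
    rw [← tsum_mul_left]
    refine ((hsum 0 le_rfl).mul_left _).tsum_le_tsum (fun k => ?_) (hrow N)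
    rw [← mul_assoc, ← mul_assoc]
    exact mul_le_mul_of_nonneg_right (pow_mul_two_sided_le hβ N k) (sq_nonneg _)
  calc β ^ N * Γ t N ^ 2
      ≤ β ^ N * (Real.exp (C * t) * ∑' k : ℕ, (β ^ 2)⁻¹ ^ ((N : ℤ) - k).natAbs * Γ 0 k ^ 2) :=
        mul_le_mul_of_nonneg_left (hterm.trans hgrow) (by positivity)
    _ = Real.exp (C * t) *
          (β ^ N * ∑' k : ℕ, (β ^ 2)⁻¹ ^ ((N : ℤ) - k).natAbs * Γ 0 k ^ 2) := by ring
    _ ≤ _ := mul_le_mul hexp hcmp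
        (mul_nonneg (by positivity) (tsum_nonneg fun k => by positivity)) (Real.exp_pos _).le

end

/-! ### Dissipation of the distance to a geometric distribution -/

section

variable {ν c S : ℝ} {h : ℝ → ℝ} {γ : ℕ → ℝ}

theorem hasSum_geometric_mul (hc : 1 < c) (hS : S = 1 - (c ^ 2)⁻¹) :
    HasSum (fun k : ℕ => (c ^ 2)⁻¹ ^ k * S) 1 := by
  have hlt : (c ^ 2)⁻¹ < 1 := inv_lt_one_of_one_lt₀ (one_lt_pow₀ hc two_ne_zero)
  have := (hasSum_geometric_of_lt_one (by positivity) hlt).mul_right S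
  rwa [hS, inv_mul_cancel₀ (by linarith), ← hS] at this

theorem sq_pow_mul_inv_pow (hc : c ≠ 0) (k : ℕ) : (c ^ 2) ^ k * (c ^ 2)⁻¹ ^ k = 1 := by
  rw [← mul_pow, mul_inv_cancel₀ (pow_ne_zero 2 hc), one_pow]

/-- The weighted square sum of a distribution is that of its distance to the geometric
distribution, up to a constant. -/
theorem hasSum_centered_iff (hc : 1 < c) (hS : S = 1 - (c ^ 2)⁻¹) (hγ : IsProbDist γ) {A : ℝ} :
    HasSum (fun k => (c ^ 2) ^ k * (γ k - (c ^ 2)⁻¹ ^ k * S) ^ 2) A ↔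
      HasSum (fun k => (c ^ 2) ^ k * γ k ^ 2) (A + S) := by
  have hc0 : c ≠ 0 := by linarith
  have hπ := hasSum_geometric_mul hc hS
  -- As `(c ^ 2) ^ k` times the geometric weight equals `S`, expanding the square leaves only these
  -- linear terms.
  have hlin : HasSum (fun k => 2 * S * γ k - S * ((c ^ 2)⁻¹ ^ k * S)) S := by
    convert! (hγ.hasSum_one.mul_left (2 * S)).sub (hπ.mul_left S) using 1; ring
  have hpt : ∀ k, (c ^ 2) ^ k * γ k ^ 2 = (c ^ 2) ^ k * (γ k - (c ^ 2)⁻¹ ^ k * S) ^ 2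
      + (2 * S * γ k - S * ((c ^ 2)⁻¹ ^ k * S)) := fun k => by
    linear_combination (S ^ 2 * (c ^ 2)⁻¹ ^ k - 2 * S * γ k) * -(sq_pow_mul_inv_pow hc0 k)
  constructor
  · intro hA
    simp only [hpt]
    exact hA.add hlin
  · intro hE
    have := hE.sub hlin
    simp only [hpt, add_sub_cancel_right] at this
    exact this

/-- The production of the weighted square sum along the non-linear M/M/1 system. -/
theorem hasSum_mul_field (hc : 1 < c) (hS : S = 1 - (c ^ 2)⁻¹) (hγ : IsProbDist γ)
    {y : ℕ → ℝ} (hy : ∀ k, y k = c ^ k * (γ k - (c ^ 2)⁻¹ ^ k * S)) {A P δ : ℝ}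
    (hA : HasSum (fun k => y k ^ 2) A) (hP : HasSum (fun k => y k * y (k + 1)) P)
    (hδ : ν * h (γ 0) = c ^ 2 + δ) :
    HasSum (fun k => (c ^ 2) ^ k * (γ k * field ν h γ k))
      (δ * S * y 0 - (c ^ 2 * (A - y 0 ^ 2) + A - 2 * c * P)
        - δ * (A - y 0 ^ 2) + δ / c * P) := by
  have hc0 : c ≠ 0 := by linarith
  have hπ := hasSum_geometric_mul hc hS
  have hγ1 := hγ.hasSum_one
  set J : ℕ → ℝ := fun j => γ j - ν * h (γ 0) * γ (j + 1) with hJ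
  have hcy : ∀ k, c⁻¹ ^ k * y k = γ k - (c ^ 2)⁻¹ ^ k * S := fun k => by
    rw [hy, ← mul_assoc, ← mul_pow, inv_mul_cancel₀ hc0, one_pow, one_mul]
  have hy0 : HasSum (fun k => c⁻¹ ^ k * y k) 0 := by
    simpa only [hcy, sub_self] using hγ1.sub hπ
  have hJs : HasSum J (1 - ν * h (γ 0) * (1 - γ 0)) :=
    hγ1.sub ((hasSum_succ hγ1).mul_left _)
  -- The equilibrium carries no flux at rate `c ^ 2`; at rate `c ^ 2 + δ` it contributes the first
  -- term only.
  have hcJ : ∀ k, c ^ k * J k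
      = -(δ * S / c ^ 2) * c⁻¹ ^ k + (y k - c * y (k + 1)) - δ / c * y (k + 1) := by
    intro k
    have e1 := hcy k
    have e2 := hcy (k + 1)
    have e3 : c ^ k * c⁻¹ ^ k = 1 := by rw [← mul_pow, mul_inv_cancel₀ hc0, one_pow]
    have e4 : (c ^ 2)⁻¹ ^ k = c⁻¹ ^ k * c⁻¹ ^ k := by rw [← mul_pow, ← sq, inv_pow c 2]
    have g1 : γ k = c⁻¹ ^ k * y k + c⁻¹ ^ k * c⁻¹ ^ k * S := by rw [e1, e4]; ring
    have g2 : γ (k + 1) = c⁻¹ ^ k * c⁻¹ * y (k + 1) + c⁻¹ ^ k * c⁻¹ ^ k * (c ^ 2)⁻¹ * S := by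
      rw [← pow_succ, e2, pow_succ (c ^ 2)⁻¹, e4]; ring
    simp only [hJ, g1, g2, hδ]
    have : ∀ z : ℝ, c ^ k * (c⁻¹ ^ k * z) = z := fun z => by rw [← mul_assoc, e3, one_mul]
    calc _ = c ^ k * (c⁻¹ ^ k * (y k + c⁻¹ ^ k * S
          - (c ^ 2 + δ) * (c⁻¹ * y (k + 1) + c⁻¹ ^ k * (c ^ 2)⁻¹ * S))) := by ring
      _ = _ := by rw [this]; field_simp; ring
  have hsq : HasSum (fun k => (c * y (k + 1) - y k) * (c ^ k * J k))
      (δ * S * y 0 - (c ^ 2 * (A - y 0 ^ 2) + A - 2 * c * P)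
        - δ * (A - y 0 ^ 2) + δ / c * P) := by
    have t1 := (((hasSum_succ hy0).mul_left (c ^ 2)).sub hy0).mul_left (-(δ * S / c ^ 2))
    have t2 := (((hasSum_succ hA).mul_left (c ^ 2)).add hA).sub (hP.mul_left (2 * c))
    have t3 := (((hasSum_succ hA).mul_left c).sub hP).mul_left (δ / c)
    convert! (t1.sub t2).sub t3 using 1
    · ext k
      have e' : c⁻¹ ^ (k + 1) = c⁻¹ ^ k / c := by rw [pow_succ, div_eq_mul_inv]
      rw [hcJ, e']
      generalize c⁻¹ ^ k = x
      field_simp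
      ring
    · field_simp
      ring
  have hw : Summable fun k => c ^ k * y k * J k := by
    have s1 := (hy0.summable.mul_left (-(δ * S / c ^ 2)))
    have s2 := (hA.summable.sub (hP.summable.mul_left c)).sub (hP.summable.mul_left (δ / c))
    refine (s1.add s2).congr fun k => ?_
    rw [mul_comm (c ^ k) (y k), mul_assoc, hcJ]
    ring
  have hw' : Summable fun k => c ^ (k + 1) * y (k + 1) * J k := by
    refine (hsq.summable.add hw).congr fun k => ?_
    ring
  -- Summation by parts; `prev J 0 = 0` removes the boundary term.
  have hprev : HasSum (fun k => c ^ k * y k * prev J k)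
      (∑' k, c ^ (k + 1) * y (k + 1) * J k) := by
    refine (hasSum_nat_add_iff' 1).1 ?_
    simpa [prev] using hw'.hasSum
  have htot : HasSum (fun k => c ^ k * y k * (prev J k - J k))
      (δ * S * y 0 - (c ^ 2 * (A - y 0 ^ 2) + A - 2 * c * P)
        - δ * (A - y 0 ^ 2) + δ / c * P) := by
    have e : HasSum (fun k => c ^ (k + 1) * y (k + 1) * J k - c ^ k * y k * J k)
        (δ * S * y 0 - (c ^ 2 * (A - y 0 ^ 2) + A - 2 * c * P)
          - δ * (A - y 0 ^ 2) + δ / c * P) := by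
      convert! hsq using 1
      ext k; ring
    rw [(hw'.hasSum.sub hw.hasSum).unique e |>.symm]
    convert! hprev.sub hw.hasSum using 1
    ext k; ring
  -- Split `(c ^ 2) ^ k * γ k = S + c ^ k * y k`: the constant part contributes `0` by conservation
  -- of mass.
  have hflat := ((hasSum_prev hJs).sub hJs).mul_left S
  convert! hflat.add htot using 1
  · ext k
    rw [field_eq_flux, hy]
    have e5 : (c ^ 2) ^ k = c ^ k * c ^ k := by rw [← mul_pow, sq]
    have e6 := sq_pow_mul_inv_pow hc0 k
    simp only [hJ]
    linear_combination S * (prev (fun j => γ j - ν * h (γ 0) * γ (j + 1)) k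
      - (γ k - ν * h (γ 0) * γ (k + 1))) * e6 + (γ k - (c ^ 2)⁻¹ ^ k * S) *
      (prev (fun j => γ j - ν * h (γ 0) * γ (j + 1)) k
      - (γ k - ν * h (γ 0) * γ (k + 1))) * e5
  · ring

/-- Dissipation inequality in terms of the deviation of the service rate. -/
theorem tsum_mul_field_le (hc : 1 < c) (hS : S = 1 - (c ^ 2)⁻¹) (hγ : IsProbDist γ) {A : ℝ}
    (hA : HasSum (fun k => (c ^ 2) ^ k * (γ k - (c ^ 2)⁻¹ ^ k * S) ^ 2) A) :
    ∑' k, (c ^ 2) ^ k * (γ k * field ν h γ k)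
      ≤ -(c - 1) ^ 2 * A + S * ((ν * h (γ 0) - c ^ 2) * (γ 0 - S))
        + 2 * |ν * h (γ 0) - c ^ 2| * A := by
  have hc0 : 0 < c := by linarith
  set δ := ν * h (γ 0) - c ^ 2 with hδ
  set y : ℕ → ℝ := fun k => c ^ k * (γ k - (c ^ 2)⁻¹ ^ k * S) with hy
  have hy0 : y 0 = γ 0 - S := by simp [hy]
  have hA' : HasSum (fun k => y k ^ 2) A := by
    convert! hA using 2 with k
    simp only [hy, mul_pow]
    rw [pow_right_comm]
  have hP := (summable_mul_succ hA'.summable).hasSum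
  set P := ∑' k, y k * y (k + 1)
  have hmean : HasSum (fun k => c⁻¹ ^ k * y k) 0 := by
    have := hγ.hasSum_one.sub (hasSum_geometric_mul hc hS)
    rw [sub_self] at this
    convert! this using 2 with k
    rw [hy, ← mul_assoc, ← mul_pow, inv_mul_cancel₀ hc0.ne', one_pow, one_mul]
  have hgap := spectralGap hc hA' hP hmean
  rw [(hasSum_mul_field (δ := δ) (y := y) hc hS hγ (fun k => rfl) hA' hP
    (by rw [hδ]; ring)).tsum_eq]
  have hsucc := hasSum_succ hA'
  have hy0A : y 0 ^ 2 ≤ A := sub_nonneg.1 (hsucc.nonneg fun k => sq_nonneg _)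
  have hPle : 2 * P ≤ A + (A - y 0 ^ 2) :=
    hasSum_le (fun k => by nlinarith [sq_nonneg (y k - y (k + 1))]) (hP.mul_left 2)
      (hA'.add hsucc)
  have hPge : -(2 * P) ≤ A + (A - y 0 ^ 2) := by
    have := hasSum_le (fun k => by nlinarith [sq_nonneg (y k + y (k + 1))]) (hP.mul_left (-2))
      (hA'.add hsucc)
    linarith
  have hA0 : 0 ≤ A := (sq_nonneg _).trans hy0A
  have h1 : -δ * (A - y 0 ^ 2) ≤ |δ| * A :=
    mul_le_mul (neg_le_abs δ) (by nlinarith [sq_nonneg (y 0)]) (by linarith) (abs_nonneg δ)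
  have hPabs : |P| ≤ A := abs_le.2 ⟨by nlinarith [sq_nonneg (y 0)], by nlinarith [sq_nonneg (y 0)]⟩
  have h2 : δ / c * P ≤ |δ| * A := by
    refine (le_abs_self _).trans ?_
    rw [abs_mul, abs_div, abs_of_pos hc0]
    exact mul_le_mul (div_le_self (abs_nonneg δ) hc.le) hPabs (abs_nonneg P) (abs_nonneg δ)
  rw [← hy0]
  linarith

end

/-- A continuous function which decays at rate `κ` as long as it stays below `η` decays
exponentially once it starts below `η`. -/
theorem le_mul_exp_of_deriv_le {f f' : ℝ → ℝ} {q κ η T : ℝ} (hf : ContinuousOn f (Icc 0 T))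
    (hd : ∀ t ∈ Ioo 0 T, HasDerivAt f (f' t) t) (hq : 0 ≤ q) (hqκ : q < κ)
    (hle : ∀ t ∈ Ioo 0 T, f t ≤ η → f' t ≤ -κ * f t) (h0 : 0 ≤ f 0) (hη : f 0 < η) {t : ℝ}
    (ht : t ∈ Ico 0 T) : f t ≤ f 0 * Real.exp (-q * t) := by
  rcases ht.1.eq_or_lt with rfl | htpos
  · simp
  have hbarrier : ∀ ζ, f 0 < ζ → ζ ≤ η → f t ≤ ζ * Real.exp (-q * t) := by
    intro ζ hζ hζη
    have hcont : Continuous fun x => ζ * Real.exp (-q * x) := by fun_prop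
    -- The derivative is only known on the open interval, so the comparison starts at some `s > 0`,
    -- where `f` is still below the barrier because `f 0 < ζ`.
    have hev : ∀ᶠ s in 𝓝[>] (0 : ℝ), f s < ζ * Real.exp (-q * s) := by
      have h1 : Tendsto f (𝓝[>] 0) (𝓝 (f 0)) :=
        (hf 0 ⟨le_rfl, ht.1.trans ht.2.le⟩).mono_left
          (nhdsWithin_le_of_mem (Icc_mem_nhdsGT (htpos.trans ht.2)))
      have h2 : Tendsto (fun x => ζ * Real.exp (-q * x)) (𝓝[>] 0) (𝓝 (ζ * Real.exp (-q * 0))) :=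
        (hcont.tendsto 0).mono_left nhdsWithin_le_nhds
      exact h1.eventually_lt h2 (by simpa using hζ)
    obtain ⟨s, hs, hs0, hst⟩ := (hev.and (Ioo_mem_nhdsGT htpos)).exists
    have hsub : ∀ x ∈ Ico s t, x ∈ Ioo 0 T := fun x hx =>
      ⟨hs0.trans_le hx.1, hx.2.trans ht.2⟩
    refine image_le_of_deriv_right_lt_deriv_boundary (a := s) (b := t)
      (B := fun x => ζ * Real.exp (-q * x)) (B' := fun x => ζ * (Real.exp (-q * x) * (-q * 1)))
      (hf.mono (Icc_subset_Icc hs0.le ht.2.le))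
      (fun x hx => (hd x (hsub x hx)).hasDerivWithinAt) hs.le
      (fun x => (((hasDerivAt_id x).const_mul (-q)).exp).const_mul ζ) (fun x hx hfx => ?_)
      (right_mem_Icc.2 hst.le)
    have hζ0 : 0 < ζ := h0.trans_lt hζ
    have hexp : Real.exp (-q * x) ≤ 1 :=
      Real.exp_le_one_iff.2 (by nlinarith [hs0.trans_le hx.1])
    have hB : 0 < ζ * Real.exp (-q * x) := mul_pos hζ0 (Real.exp_pos _)
    have := hle x (hsub x hx) (hfx.le.trans ((mul_le_of_le_one_right hζ0.le hexp).trans hζη))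
    rw [hfx] at this
    nlinarith [mul_pos (sub_pos.2 hqκ) hB]
  have hE := Real.exp_pos (-q * t)
  rw [← div_le_iff₀ hE]
  refine le_of_forall_gt_imp_ge_of_dense fun ζ hζ => ?_
  rw [div_le_iff₀ hE]
  refine (hbarrier (min ζ η) (lt_min hζ hη) (min_le_right _ _)).trans ?_
  exact mul_le_mul_of_nonneg_right (min_le_left _ _) hE.le

/-! ### Exponential stability -/

theorem isModerateWeight_pow {β : ℝ} (hβ : 1 ≤ β) : IsModerateWeight β fun k => β ^ k := by
  have h0 : 0 ≤ β := by linarith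
  refine ⟨fun k => by positivity, fun k => ?_, fun k => (pow_succ' β k).le⟩
  rw [← pow_succ']
  exact pow_le_pow_right₀ hβ (by omega)

section

variable {ν c S m K B : ℝ} {h : ℝ → ℝ}

/-- Dissipation inequality for a service rate that is differentiable at `S`, with a quadratic
control of the remainder. -/
theorem tsum_mul_field_le_of_deriv (hν : 0 ≤ ν) (hc : 1 < c) (hS : S = 1 - (c ^ 2)⁻¹)
    (hS0 : 0 ≤ S) (hS1 : S ≤ 1) (hfix : ν * h S = c ^ 2) (hK : 0 ≤ K)
    (hm : ∀ x ∈ Icc (0 : ℝ) 1, |h x - h S - m * (x - S)| ≤ K * (x - S) ^ 2)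
    {γ : ℕ → ℝ} (hγ : IsProbDist γ) {A : ℝ}
    (hA : HasSum (fun k => (c ^ 2) ^ k * (γ k - (c ^ 2)⁻¹ ^ k * S) ^ 2) A) :
    ∑' k, (c ^ 2) ^ k * (γ k * field ν h γ k)
      ≤ -((c - 1) ^ 2 - ν * S * |m| - ν * (3 * K + 2 * |m|) * |γ 0 - S|) * A := by
  have hmain := tsum_mul_field_le (ν := ν) (h := h) hc hS hγ hA
  set g := γ 0 - S with hg
  have hgA : g ^ 2 ≤ A := by
    have := le_hasSum hA 0 fun k _ => by positivity
    simpa using this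
  have hA0 : 0 ≤ A := (sq_nonneg g).trans hgA
  have hx := hγ.mem_Icc 0
  have hg1 : |g| ≤ 1 := abs_le.2 ⟨by linarith [hx.1], by linarith [hx.2]⟩
  have hrem := hm _ hx
  rw [← hg] at hrem
  set e := h (γ 0) - h S - m * g with he
  have hδ : ν * h (γ 0) - c ^ 2 = ν * (m * g + e) := by rw [← hfix, he]; ring
  have hgg : g ^ 2 = |g| * |g| := by rw [abs_mul_abs_self, sq]
  have hag : 0 ≤ |g| := abs_nonneg g
  have heg : |e| ≤ K * |g| :=
    hrem.trans (mul_le_mul_of_nonneg_left (by rw [hgg]; nlinarith) hK)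
  have h1 : (m * g + e) * g ≤ (|m| + K * |g|) * A := by
    have h2 : m * g * g ≤ |m| * g ^ 2 := by
      rw [mul_assoc, ← sq]; exact mul_le_mul_of_nonneg_right (le_abs_self m) (sq_nonneg g)
    have h3 : e * g ≤ K * |g| * g ^ 2 := by
      refine (le_abs_self _).trans ?_
      rw [abs_mul]
      nlinarith
    have h4 : (|m| + K * |g|) * g ^ 2 ≤ (|m| + K * |g|) * A :=
      mul_le_mul_of_nonneg_left hgA (by positivity)
    linarith
  have h5 : |m * g + e| ≤ (|m| + K) * |g| := by
    refine (abs_add_le _ _).trans ?_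
    rw [abs_mul]; linarith
  rw [hδ] at hmain
  rw [abs_mul, abs_of_nonneg hν] at hmain
  have h6 : S * (ν * (m * g + e) * g) ≤ ν * S * |m| * A + ν * K * |g| * A := by
    have := mul_le_mul_of_nonneg_left h1 (mul_nonneg hS0 hν)
    have h7 : S * (ν * K * |g| * A) ≤ ν * K * |g| * A :=
      mul_le_of_le_one_left (by positivity) hS1
    linarith
  have h8 : 2 * (ν * |m * g + e|) * A ≤ 2 * (ν * ((|m| + K) * |g|)) * A := by gcongr
  linarith

/-- Decay of the weighted square distance to the geometric equilibrium. -/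
theorem IsSolution.exists_decay (hν : 0 < ν) (hc : 1 < c) (hS : S = 1 - (c ^ 2)⁻¹)
    (hS0 : 0 ≤ S) (hS1 : S ≤ 1) (hfix : ν * h S = c ^ 2) (hK : 0 ≤ K)
    (hB : ∀ x ∈ Icc (0 : ℝ) 1, 0 ≤ ν * h x ∧ ν * h x ≤ B)
    (hm : ∀ x ∈ Icc (0 : ℝ) 1, |h x - h S - m * (x - S)| ≤ K * (x - S) ^ 2)
    (hstab : ν * S * |m| < (c - 1) ^ 2) :
    ∃ q > 0, ∃ η > 0, ∀ Γ : ℝ → ℕ → ℝ, IsSolution ν h Γ → ∀ A₀,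
      HasSum (fun k => (c ^ 2) ^ k * (Γ 0 k - (c ^ 2)⁻¹ ^ k * S) ^ 2) A₀ → A₀ < η →
      ∀ t, 0 ≤ t → ∃ A, HasSum (fun k => (c ^ 2) ^ k * (Γ t k - (c ^ 2)⁻¹ ^ k * S) ^ 2) A ∧
        A ≤ A₀ * Real.exp (-q * t) := by
  set κ := (c - 1) ^ 2 - ν * S * |m| with hκ
  have hκ0 : 0 < κ := sub_pos.2 hstab
  set L := ν * (3 * K + 2 * |m|) with hL
  have hL0 : 0 ≤ L := by positivity
  -- While `|Γ s 0 - S| ≤ r`, the remainder consumes at most half of `κ`; the `+ 1` covers `L = 0`.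
  set r := κ / (2 * (L + 1)) with hr
  have hr0 : 0 < r := by positivity
  have hLr : L * r ≤ κ / 2 := by
    rw [hr, mul_div_assoc', div_le_div_iff₀ (by positivity) two_pos]
    nlinarith
  -- Differentiating the square doubles the remaining `κ / 2`, so the decay rate is `κ`; the choice
  -- `q = κ / 2` gives the strict gap the barrier needs.
  refine ⟨κ / 2, by positivity, r ^ 2, by positivity, fun Γ hΓ A₀ hA₀ hη t ht => ?_⟩
  have hβ : 1 < c ^ 2 := one_lt_pow₀ hc two_ne_zero
  have hE₀ := (hasSum_centered_iff hc hS (hΓ.isProbDist 0 le_rfl)).1 hA₀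
  obtain ⟨u, hu, hwu⟩ := hΓ.exists_majorant hB hβ hE₀.summable (t + 1)
  obtain ⟨hcont, hderiv⟩ := hΓ.weighted_regularity (K := c ^ 2) (w := fun k => (c ^ 2) ^ k) hB
    (by positivity) (isModerateWeight_pow hβ.le) hu hwu
  set E : ℝ → ℝ := fun s => ∑' k, (c ^ 2) ^ k * Γ s k ^ 2 with hEdef
  have hE : ∀ s ∈ Icc 0 (t + 1), HasSum (fun k => (c ^ 2) ^ k * Γ s k ^ 2) (E s) := fun s hs =>
    (Summable.of_nonneg_of_le (fun k => by positivity) (hwu s hs) hu).hasSum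
  have hA : ∀ s ∈ Icc 0 (t + 1),
      HasSum (fun k => (c ^ 2) ^ k * (Γ s k - (c ^ 2)⁻¹ ^ k * S) ^ 2) (E s - S) := fun s hs =>
    (hasSum_centered_iff hc hS (hΓ.isProbDist s hs.1)).2 (by simpa using hE s hs)
  have h0mem : (0 : ℝ) ∈ Icc 0 (t + 1) := ⟨le_rfl, by linarith⟩
  have hE0 : E 0 - S = A₀ := (hA 0 h0mem).unique hA₀
  refine ⟨_, hA t ⟨ht, by linarith⟩, ?_⟩
  rw [← hE0] at hη ⊢
  refine le_mul_exp_of_deriv_le (f := fun s => E s - S) (κ := κ) (η := r ^ 2)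
    (hcont.sub continuousOn_const) (fun s hs => (hderiv s hs).sub_const S) (by positivity)
    (by linarith) (fun s hs hle => ?_) ((hA 0 h0mem).nonneg fun k => by positivity) hη
    ⟨ht, by linarith⟩
  have hs' := Ioo_subset_Icc_self hs
  have hdis := tsum_mul_field_le_of_deriv hν.le hc hS hS0 hS1 hfix hK hm
    (hΓ.isProbDist s hs.1.le) (hA s hs')
  have hpos : 0 ≤ E s - S := (hA s hs').nonneg fun k => by positivity
  have hg : |Γ s 0 - S| ≤ r := by
    have := le_hasSum (hA s hs') 0 fun k _ => by positivity
    refine abs_le_of_sq_le_sq (le_trans ?_ hle) hr0.le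
    simpa using this
  have hLg : L * |Γ s 0 - S| ≤ κ / 2 := (mul_le_mul_of_nonneg_left hg hL0).trans hLr
  have htwo : ∑' k, (c ^ 2) ^ k * (2 * Γ s k * field ν h (Γ s) k)
      = 2 * ∑' k, (c ^ 2) ^ k * (Γ s k * field ν h (Γ s) k) := by
    rw [← tsum_mul_left]
    exact tsum_congr fun k => by ring
  rw [htwo]
  nlinarith [mul_le_mul_of_nonneg_right hLg hpos]

end

theorem distSq_eq_ofReal {μ p : ℕ → ℝ} (hp : ∀ k, 0 < p k) {s : ℝ}
    (hs : HasSum (fun k => (μ k - p k) ^ 2 / p k) s) : distSq μ p = ENNReal.ofReal s := by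
  rw [← hs.tsum_eq, ENNReal.ofReal_tsum_of_nonneg
    (fun k => div_nonneg (sq_nonneg _) (hp k).le) hs.summable]
  exact tsum_congr fun k => (ENNReal.ofReal_div_of_pos (hp k)).symm

theorem summable_of_distSq_ne_top {μ p : ℕ → ℝ} (hp : ∀ k, 0 < p k) (h : distSq μ p ≠ ∞) :
    Summable fun k => (μ k - p k) ^ 2 / p k := by
  refine (ENNReal.summable_toReal h).congr fun k => ?_
  rw [← ENNReal.ofReal_div_of_pos (hp k),
    ENNReal.toReal_ofReal (div_nonneg (sq_nonneg _) (hp k).le)]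

theorem isFixedPoint_piS {ν S : ℝ} {h : ℝ → ℝ} (hβ : 1 < ν * h S)
    (hfix : S = 1 - 1 / (ν * h S)) : IsFixedPoint ν h (piS ν h S) := by
  have hβ0 : 0 < ν * h S := by linarith
  have hlt : 1 / (ν * h S) < 1 := (div_lt_one hβ0).2 hβ
  have h0 : piS ν h S 0 = S := by simp only [piS, pow_zero, one_mul]; exact hfix.symm
  have hbal : ∀ k, ν * h S * piS ν h S (k + 1) = piS ν h S k := fun k => by
    rw [piS, piS, pow_succ, ← mul_assoc, mul_left_comm, mul_one_div_cancel hβ0.ne', mul_one]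
  refine ⟨⟨fun k => mul_nonneg (by positivity) (by linarith), ?_⟩, fun k => ?_⟩
  · have := (hasSum_geometric_of_lt_one (by positivity) hlt).mul_right (1 - 1 / (ν * h S))
    rwa [inv_mul_cancel₀ (by linarith)] at this
  · cases k with
    | zero => simp only [field, h0]; rw [hbal 0, h0, sub_self]
    | succ k =>
      simp only [field, h0]
      rw [hbal (k + 1)]
      linear_combination -hbal k

/-- Exponential stability of a geometric equilibrium under the stability condition. -/
theorem isExpStable_piS {ν S m K B : ℝ} {h : ℝ → ℝ} (hν : 0 < ν) (hSmem : S ∈ Ioo (0 : ℝ) 1)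
    (hfix : S = 1 - 1 / (ν * h S)) (hK : 0 ≤ K)
    (hB : ∀ x ∈ Icc (0 : ℝ) 1, 0 ≤ ν * h x ∧ ν * h x ≤ B)
    (hm : ∀ x ∈ Icc (0 : ℝ) 1, |h x - h S - m * (x - S)| ≤ K * (x - S) ^ 2)
    (hstab : |m| < 1 / (ν * S) * (1 / √(1 - S) - 1) ^ 2) :
    IsExpStable ν h (piS ν h S) := by
  obtain ⟨hS0, hS1⟩ := hSmem
  have hinv : 1 / (ν * h S) = 1 - S := by linarith
  have hβ0 : 0 < ν * h S := one_div_pos.1 (by rw [hinv]; linarith)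
  have hβ : 1 < ν * h S := by
    rw [← one_div_lt_one_div hβ0 one_pos, hinv]; linarith
  set c := √(ν * h S) with hcdef
  have hc2 : c ^ 2 = ν * h S := Real.sq_sqrt hβ0.le
  have hc : 1 < c := Real.lt_sqrt_of_sq_lt (by simpa using hβ)
  have hSc : S = 1 - (c ^ 2)⁻¹ := by rw [hc2, ← one_div]; exact hfix
  have hsqrt : 1 / √(1 - S) = c := by
    rw [← hinv, one_div (ν * h S), Real.sqrt_inv, one_div, inv_inv]
  have hstab' : ν * S * |m| < (c - 1) ^ 2 := by
    rw [hsqrt, one_div_mul_eq_div, lt_div_iff₀ (by positivity)] at hstab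
    linarith
  have hpi : ∀ k, piS ν h S k = (c ^ 2)⁻¹ ^ k * S := fun k => by
    rw [piS, hc2, ← one_div, ← hfix]
  have hpos : ∀ k, 0 < piS ν h S k := fun k => by rw [hpi]; positivity
  have hterm : ∀ μ : ℕ → ℝ, ∀ k, (μ k - piS ν h S k) ^ 2 / piS ν h S k
      = S⁻¹ * ((c ^ 2) ^ k * (μ k - (c ^ 2)⁻¹ ^ k * S) ^ 2) := fun μ k => by
    rw [hpi, inv_pow]
    field_simp
  obtain ⟨q, hq, η, hη, hdecay⟩ := IsSolution.exists_decay hν hc hSc hS0.le hS1.le hc2.symm hK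
    hB hm hstab'
  -- The squared distance is `A₀ / S` with `S < 1`; halving `η` makes `A₀ < η` strict.
  refine ⟨isFixedPoint_piS hβ hfix, q, hq, √(η / 2), by positivity, fun Γ hΓ h0 t ht => ?_⟩
  rw [Real.sq_sqrt (by positivity)] at h0
  have hsum := summable_of_distSq_ne_top hpos (h0.trans_lt ENNReal.ofReal_lt_top).ne
  have hsumA : Summable fun k => (c ^ 2) ^ k * (Γ 0 k - (c ^ 2)⁻¹ ^ k * S) ^ 2 := by
    refine (hsum.mul_left S).congr fun k => ?_
    rw [hterm, mul_inv_cancel_left₀ hS0.ne']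
  obtain ⟨A₀, hA₀⟩ := hsumA
  have hd0 : distSq (Γ 0) (piS ν h S) = ENNReal.ofReal (S⁻¹ * A₀) :=
    distSq_eq_ofReal hpos (by simpa only [hterm] using hA₀.mul_left S⁻¹)
  have hA₀nn : 0 ≤ A₀ := hA₀.nonneg fun k => by positivity
  have hA₀η : A₀ < η := by
    rw [hd0, ENNReal.ofReal_le_ofReal_iff (by positivity), inv_mul_le_iff₀ hS0] at h0
    nlinarith
  obtain ⟨A, hA, hle⟩ := hdecay Γ hΓ A₀ hA₀ hA₀η t ht
  rw [hd0, distSq_eq_ofReal hpos (by simpa only [hterm] using hA.mul_left S⁻¹),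
    ← ENNReal.ofReal_mul (by positivity), mul_assoc]
  exact ENNReal.ofReal_le_ofReal (mul_le_mul_of_nonneg_left hle (by positivity))

/-! ### Fixed points -/

/-- A fixed point is a geometric distribution whose mass at `0` solves the fixed point equation. -/
theorem IsFixedPoint.eq_piS {ν : ℝ} {h : ℝ → ℝ} {p : ℕ → ℝ} (hp : IsFixedPoint ν h p)
    (hβ0 : 0 < ν * h (p 0)) :
    p 0 ∈ Ioo (0 : ℝ) 1 ∧ p 0 = 1 - 1 / (ν * h (p 0)) ∧ p = piS ν h (p 0) := by
  obtain ⟨hprob, hfield⟩ := hp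
  set β := ν * h (p 0) with hβ
  -- The flux vanishes at `0`, and stationarity makes it constant in `k`.
  have hbal : ∀ k, β * p (k + 1) = p k := by
    intro k
    induction k with
    | zero =>
      have := hfield 0
      simp only [field, ← hβ] at this
      linarith
    | succ k ih =>
      have := hfield (k + 1)
      simp only [field, ← hβ] at this
      linarith
  have hgeo : ∀ k, p k = (1 / β) ^ k * p 0 := by
    intro k
    induction k with
    | zero => simp
    | succ k ih =>
      rw [pow_succ, mul_right_comm, ← ih, ← hbal k]
      field_simp
  have hsum := hprob.hasSum_one
  rw [funext hgeo] at hsum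
  have hp0 : 0 < p 0 := by
    refine (hprob.nonneg 0).lt_of_ne fun h0 => ?_
    rw [← h0] at hsum
    simp only [mul_zero] at hsum
    exact zero_ne_one (hasSum_zero.unique hsum)
  have hlt : 1 / β < 1 := by
    have hs : Summable fun k : ℕ => (1 / β) ^ k :=
      (hsum.summable.mul_right (p 0)⁻¹).congr fun k => mul_inv_cancel_right₀ hp0.ne' _
    have := summable_geometric_iff_norm_lt_one.1 hs
    rwa [Real.norm_of_nonneg (by positivity)] at this
  have hval : p 0 = 1 - 1 / β := by
    have h1 := ((hasSum_geometric_of_lt_one (by positivity) hlt).mul_right (p 0)).unique hsum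
    rwa [inv_mul_eq_one₀ (by linarith), eq_comm] at h1
  refine ⟨⟨hp0, ?_⟩, hval, funext fun k => ?_⟩
  · rw [hval]; linarith [one_div_pos.2 hβ0]
  · rw [piS, ← hβ, ← hval]; exact hgeo k

/-! ### The rate `darRate` -/

section

variable {a : ℝ}

theorem darRate_pos (ha : 0 ≤ a) {x : ℝ} (hx : x ∈ Icc (0 : ℝ) 1) : 0 < darRate a x := by
  have := mul_nonneg (mul_nonneg ha hx.1) (sub_nonneg.2 hx.2)
  simp only [darRate]; linarith

theorem darRate_le (ha : 0 ≤ a) {x : ℝ} (hx : x ∈ Icc (0 : ℝ) 1) : darRate a x ≤ 1 + a := by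
  have : x * (1 - x) ≤ 1 := mul_le_one₀ hx.2 (sub_nonneg.2 hx.2) (by linarith [hx.1])
  simp only [darRate]; nlinarith

theorem hasDerivAt_darRate (a x : ℝ) : HasDerivAt (darRate a) (a * (1 - 2 * x)) x := by
  have := (((hasDerivAt_id x).const_mul a).mul ((hasDerivAt_id x).const_sub 1)).const_add 1
  convert! this using 1
  simp; ring

/-- The fixed point equation in polynomial form. -/
theorem fixed_iff {ν S : ℝ} (hβ : ν * darRate a S ≠ 0) :
    S = 1 - 1 / (ν * darRate a S) ↔ ν * ((1 - S) * darRate a S) = 1 := by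
  rw [eq_sub_iff_add_eq, ← eq_sub_iff_add_eq', div_eq_iff hβ]
  constructor <;> intro h <;> linarith

/-- A solution of the fixed point equation above `1/3` is the largest one. -/
theorem le_of_fixed {ν S x : ℝ} (ha : 0 ≤ a) (hν : 0 < ν) (hS : 1 / 3 < S) (hx : x < 1)
    (hSfix : ν * ((1 - S) * darRate a S) = 1) (hxfix : ν * ((1 - x) * darRate a x) = 1) :
    x ≤ S := by
  by_contra! hlt
  have heq : (1 - S) * darRate a S = (1 - x) * darRate a x :=
    mul_left_cancel₀ hν.ne' (hSfix.trans hxfix.symm)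
  have hfac : (x - S) * (1 + a * (x * (2 - x - S) + S * (2 - S) - 1)) = 0 := by
    simp only [darRate] at heq; linear_combination heq
  -- This reflects that `z (1 - z) ^ 2` has derivative `(1 - z) (1 - 3 z)`, hence decreases on
  -- `[1/3, 1]`.
  have hpos : 0 ≤ x * (2 - x - S) + S * (2 - S) - 1 := by
    nlinarith [mul_pos (sub_pos.2 hx) (sub_pos.2 hlt),
      mul_pos (sub_pos.2 (hlt.trans hx)) (sub_pos.2 hS), mul_pos (sub_pos.2 hx) (sub_pos.2 hS)]
  rcases mul_eq_zero.1 hfac with h | h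
  · linarith
  · nlinarith [mul_nonneg ha hpos]

/-- For `ν ≥ 1` the fixed point equation has at most one solution in `(0, 1)`. -/
theorem eq_of_fixed {ν S x : ℝ} (ha : 0 < a) (hν : 1 ≤ ν) (hS : S ∈ Ioo (0 : ℝ) 1)
    (hx : x ∈ Ioo (0 : ℝ) 1) (hSfix : ν * ((1 - S) * darRate a S) = 1)
    (hxfix : ν * ((1 - x) * darRate a x) = 1) : x = S := by
  have hν0 : 0 < ν := by linarith
  by_contra hne
  have heq : (1 - S) * darRate a S = (1 - x) * darRate a x :=
    mul_left_cancel₀ hν0.ne' (hSfix.trans hxfix.symm)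
  have hle : (1 - S) * darRate a S ≤ 1 := by
    by_contra! hgt
    nlinarith
  have hfac : (x - S) * (1 + a * (x * (2 - x - S) + S * (2 - S) - 1)) = 0 := by
    simp only [darRate] at heq; linear_combination heq
  have hquad := (mul_eq_zero.1 hfac).resolve_left (sub_ne_zero.2 hne)
  -- Vieta: the roots of the cubic sum to `2`, so the third is `2 - x - S > 0`, while their product
  -- is `(1 / ν - 1) / a ≤ 0`.
  have hprod : 0 < a * (x * S * (2 - x - S)) := by
    have h1 := hx.1
    have h2 := hS.1
    have h3 : 0 < 2 - x - S := by linarith [hx.2, hS.2]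
    positivity
  simp only [darRate] at hle
  have : (1 - S) * (1 + a * S * (1 - S)) = 1 + a * (x * S * (2 - x - S)) := by
    linear_combination -S * hquad
  linarith

end

/-! ### The main theorem -/

/-- A continuous local branch of solutions of the fixed point equation through
`(8 / (4 + a), 1 / 2)`. -/
theorem exists_fixed_branch {a : ℝ} (ha : 0 < a) :
    ∃ V ∈ 𝓝 (8 / (4 + a)), ∃ σ : ℝ → ℝ, V ⊆ Ioi 0 ∧ σ (8 / (4 + a)) = 1 / 2 ∧
      ContinuousOn σ V ∧ ∀ ν ∈ V, ν * ((1 - σ ν) * darRate a (σ ν)) = 1 := by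
  set F : ℝ → ℝ := fun x => (1 - x) * darRate a x with hF
  have hF2 : F (1 / 2) = (8 / (4 + a))⁻¹ := by
    simp only [hF, darRate, inv_div]; ring
  have hd : HasDerivAt F (-(1 + a / 4)) (1 / 2) := by
    have := ((hasDerivAt_id (1 / 2 : ℝ)).const_sub 1).mul (hasDerivAt_darRate a (1 / 2))
    convert! this using 1
    simp only [id, darRate]; ring
  have hcd : ContDiff ℝ 1 F := by
    simp only [hF, darRate]; fun_prop
  have hs : HasStrictDerivAt F (-(1 + a / 4)) (1 / 2) :=
    hcd.contDiffAt.hasStrictDerivAt' hd one_ne_zero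
  have hs' := hs.hasStrictFDerivAt_equiv (by linarith : -(1 + a / 4) ≠ 0)
  set e := hs'.toOpenPartialHomeomorph F
  have hmem : (1 / 2 : ℝ) ∈ e.source := hs'.mem_toOpenPartialHomeomorph_source
  have hcoe : ∀ x, e x = F x := fun x => rfl
  have hu : 0 < 8 / (4 + a) := by positivity
  have hinv : ContinuousOn (fun ν : ℝ => ν⁻¹) (Ioi 0) :=
    continuousOn_inv₀.mono fun ν hν => ne_of_gt hν
  have hopen : IsOpen (Ioi (0 : ℝ) ∩ (fun ν : ℝ => ν⁻¹) ⁻¹' e.target) :=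
    hinv.isOpen_inter_preimage isOpen_Ioi e.open_target
  have htarget : F (1 / 2) ∈ e.target := by rw [← hcoe]; exact e.map_source hmem
  refine ⟨_, hopen.mem_nhds ⟨hu, ?_⟩, fun ν => e.symm ν⁻¹, inter_subset_left, ?_, ?_, ?_⟩
  · rw [mem_preimage, ← hF2]; exact htarget
  · change e.symm (8 / (4 + a))⁻¹ = 1 / 2
    rw [← hF2, ← hcoe]; exact e.left_inv hmem
  · exact e.continuousOn_symm.comp (hinv.mono inter_subset_left) fun ν hν => hν.2
  · intro ν hν
    have := e.right_inv hν.2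
    rw [hcoe] at this
    change ν * F (e.symm ν⁻¹) = 1
    rw [this, mul_inv_cancel₀ (ne_of_gt hν.1)]

/-- At `S = 1 / 2` the derivative of `darRate a` vanishes, so the stability condition holds along
continuous branches through this point. -/
theorem eventually_stabilityCondition {a u : ℝ} {σ : ℝ → ℝ} (hu : 0 < u) (hσu : σ u = 1 / 2)
    (hσ : ContinuousAt σ u) : ∀ᶠ ν in 𝓝 u, StabilityCondition ν (darRate a) (σ ν) := by
  have hderiv : ∀ S, deriv (darRate a) S = a * (1 - 2 * S) := fun S =>
    (hasDerivAt_darRate a S).deriv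
  have hsqrt : √(1 - σ u) ≠ 0 := by
    rw [hσu]; exact (Real.sqrt_pos.2 (by norm_num)).ne'
  have hlt : √(1 - σ u) < 1 := by
    rw [hσu, Real.sqrt_lt' one_pos]; norm_num
  simp only [StabilityCondition, hderiv]
  refine ContinuousAt.eventually_lt (by fun_prop) ?_ ?_
  · have h1 : u * σ u ≠ 0 := by rw [hσu]; positivity
    fun_prop (disch := assumption)
  · have h2 : 0 < 1 / √(1 - σ u) - 1 := by
      rw [sub_pos, lt_div_iff₀ ((Real.sqrt_nonneg _).lt_of_ne' hsqrt)]; linarith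
    have h3 : 0 < u * σ u := by rw [hσu]; positivity
    rw [show a * (1 - 2 * σ u) = 0 by rw [hσu]; ring, abs_zero]
    positivity

end NonlinearMM1

open NonlinearMM1

theorem mainTheorem10 (a : ℝ) (ha : 1 < a) :
    ∃ I ∈ 𝓝 (8 / (4 + a)), ∃ σ : ℝ → ℝ,
      σ (8 / (4 + a)) = 1 / 2 ∧ ContinuousOn σ I ∧
      ∀ ν ∈ I,
        0 < ν ∧ σ ν ∈ Ioo (0 : ℝ) 1 ∧
        σ ν = 1 - 1 / (ν * darRate a (σ ν)) ∧
        StabilityCondition ν (darRate a) (σ ν) ∧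
        IsExpStable ν (darRate a) (piS ν (darRate a) (σ ν)) ∧
        (∀ p, IsFixedPoint ν (darRate a) p → p 0 ≤ σ ν) ∧
        (∀ p, IsFixedPoint ν (darRate a) p → p 0 = σ ν → p = piS ν (darRate a) (σ ν)) ∧
        (a < 4 ∨ 1 ≤ ν →
          ∀ p, IsFixedPoint ν (darRate a) p → p = piS ν (darRate a) (σ ν)) := by
  have ha0 : 0 < a := by linarith
  obtain ⟨V, hV, σ, hVpos, hσu, hσ, hbranch⟩ := exists_fixed_branch ha0
  set u := 8 / (4 + a) with hu
  have hu0 : 0 < u := by positivity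
  have hσat : ContinuousAt σ u := hσ.continuousAt hV
  have hmem : ∀ᶠ ν in 𝓝 u, σ ν ∈ Ioo (1 / 3 : ℝ) 1 :=
    hσat.eventually (Ioo_mem_nhds (by rw [hσu]; norm_num) (by rw [hσu]; norm_num))
  have hone : ∀ᶠ ν in 𝓝 u, a < 4 → 1 ≤ ν := by
    by_cases h4 : a < 4
    · have : 1 < u := by rw [hu, lt_div_iff₀ (by linarith)]; linarith
      filter_upwards [lt_mem_nhds this] with ν hν _ using hν.le
    · exact Eventually.of_forall fun ν h => absurd h h4
  have hstab : ∀ᶠ ν in 𝓝 u, StabilityCondition ν (darRate a) (σ ν) :=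
    eventually_stabilityCondition hu0 hσu hσat
  refine ⟨V ∩ {ν | σ ν ∈ Ioo (1 / 3 : ℝ) 1 ∧ (a < 4 → 1 ≤ ν) ∧
    StabilityCondition ν (darRate a) (σ ν)},
    inter_mem hV (hmem.and (hone.and hstab)), σ, hσu, hσ.mono inter_subset_left, ?_⟩
  rintro ν ⟨hνV, hSmem, hν1, hνstab⟩
  have hν : 0 < ν := hVpos hνV
  have hS : σ ν ∈ Ioo (0 : ℝ) 1 := ⟨by linarith [hSmem.1], hSmem.2⟩
  have hβ : ∀ x ∈ Icc (0 : ℝ) 1, 0 < ν * darRate a x := fun x hx =>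
    mul_pos hν (darRate_pos ha0.le hx)
  have hfix := (fixed_iff (hβ _ (Ioo_subset_Icc_self hS)).ne').2 (hbranch ν hνV)
  have hpfix : ∀ p, IsFixedPoint ν (darRate a) p → p 0 ∈ Ioo (0 : ℝ) 1 ∧
      ν * ((1 - p 0) * darRate a (p 0)) = 1 ∧ p = piS ν (darRate a) (p 0) := fun p hp => by
    have hb := hβ _ (hp.1.mem_Icc 0)
    obtain ⟨h1, h2, h3⟩ := hp.eq_piS hb
    exact ⟨h1, (fixed_iff hb.ne').1 h2, h3⟩
  refine ⟨hν, hS, hfix, hνstab, ?_, fun p hp => ?_, fun p hp hp0 => ?_, fun hor p hp => ?_⟩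
  -- The rate is quadratic, so its first-order Taylor remainder is exactly `-a * (x - S) ^ 2`,
  -- whence `K = a`.
  · refine isExpStable_piS (m := a * (1 - 2 * σ ν)) (K := a) (B := ν * (1 + a)) hν hS hfix ha0.le
      (fun x hx => ⟨(hβ x hx).le, mul_le_mul_of_nonneg_left (darRate_le ha0.le hx) hν.le⟩)
      (fun x _ => ?_) ?_
    · have : darRate a x - darRate a (σ ν) - a * (1 - 2 * σ ν) * (x - σ ν)
          = -(a * (x - σ ν) ^ 2) := by simp only [darRate]; ring
      rw [this, abs_neg, abs_of_nonneg (by positivity)]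
    · rwa [StabilityCondition, (hasDerivAt_darRate a (σ ν)).deriv] at hνstab
  · obtain ⟨h1, h2, -⟩ := hpfix p hp
    exact le_of_fixed ha0.le hν hSmem.1 h1.2 (hbranch ν hνV) h2
  · rw [← hp0]; exact (hpfix p hp).2.2
  · obtain ⟨h1, h2, h3⟩ := hpfix p hp
    rw [← eq_of_fixed ha0 (hor.elim hν1 id) hS h1 (hbranch ν hνV) h2]
    exact h3
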